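/- Let $H=(h_{i,j})$ be a unitary irreducible upper Hessenberg matrix, either finite of order $N\ge 1$ (an operator on $\mathbb C^N$) or infinite (an operator on $\ell^2$, with indices $1,2,3,\dots$; put $N=\infty$). Here Hessenberg means $h_{i,j}=0$ for $i>j+1$, and irreducible means $h_{n+1,n}\ne 0$ for all $n$ with $n+1\le N$. Let $$\tau_1=1,\qquad \tau_n=\prod_{k=1}^{n-1}h_{k+1,k}\quad(n\ge 2),\qquad a_n=-\frac{h_{1,n}}{\overline{\tau_n}},\qquad \rho_n=\sqrt{1-|a_n|^2}.$$ Then $\tau_n\neq0$ for all $n\le N$, $|a_n|<1$ for all $n<N$, and $|a_N|=1$ if $N<\infty$. Let $C=(c_{i,j})$ be the principal submatrix of order $N$ (the whole matrix if $N=\infty$) of $$C(\mathbf a)=\begin{pmatrix} -a_1 & -\rho_1a_2 & \rho_1\rho_2 & & & \\ \rho_1 & -\overline{a_1}a_2 & \overline{a_1}\rho_2 & 0 & & \\ 0 & -\rho_2a_3 & -\overline{a_2}a_3 & -\rho_3a_4 & \rho_3\rho_4 & \\ & \rho_2\rho_3 & \overline{a_2}\rho_3 & -\overline{a_3}a_4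 & \overline{a_3}\rho_4 & 0 \\ & & \ddots & \ddots & \ddots & \ddots \end{pmatrix}.$$ It is para-tridiagonal: $c_{i,j}=0$ for $|i-j|>2$, and $c_{2k,2k+2}=c_{2k+1,2k-1}=0$ for $k\ge1$. The matrix $C$ defines a bounded operator and is unitarily equivalent to $H$: there is a unitary matrix $V=(v_{i,j})$ with $H=V^*CV$, and $V$ is the unique matrix of the order of $H$ given by the recursion $$v_{i,j}=\begin{cases} \dfrac{\overline{\tau_j}}{|\tau_j|}\,\delta_{i,j}, & j=1,2,\\[2mm] \dfrac1{h_{j,j-1}}\left(\displaystyle\sum_{k=i-2}^{\min\{i+2,2j-4\}}c_{i,k}\,v_{k,j-1}-\sum_{k=\min\{i,\lfloor (i+3)/2\rfloor\}}^{j-1}h_{k,j-1}\,v_{i,k}\right), & i\le 2j-2,\ j\ge3,\\[2mm] 0, & i\ge 2j-1,\ j\ge 3, \end{cases}$$ where the sums run only over those terms in which all matrix indices lie between $1$ and the order of $H$. Moreover, $H$ and $C$ have the same eigenvalues, and every eigenvector of $H$ or of $C$ has a nonzero first coordinate. If $x=\sum_n x_ne_n$ and $y=\sum_n y_ne_n$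 are eigenvectors of $H$ and of $C$, respectively, for the same eigenvalue $\lambda$, normalized so that $x_1=y_1\in\mathbb R$, then $$x_{2k-1}=\frac{\tau_{2k-1}}{|\tau_{2k-1}|}\,\lambda^{1-k}\,\overline{y_{2k-1}},\qquad x_{2k}=\frac{\tau_{2k}}{|\tau_{2k}|}\,\lambda^{1-k}\,y_{2k}$$ for all $k\ge1$ for which the indices $2k-1$, respectively $2k$, do not exceed the order of $H$. -/

import Mathlib

open scoped ComplexConjugate

namespace UnitaryHessenberg

/-- The indices `1, 2, …, N` of a matrix of order `N`; for `N = ⊤` (an infinite matrix), all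
positive integers. -/
abbrev Idx (N : ℕ∞) : Type := {n : ℕ // 1 ≤ n ∧ (n : ℕ∞) ≤ N}

/-- The Hilbert space of square-summable families indexed by `Idx N`: it is `ℂ^N` with the
Euclidean norm for finite `N`, and the sequence space `ℓ²` for `N = ⊤`. -/
abbrev Space (N : ℕ∞) : Type := lp (fun _ : Idx N => ℂ) 2

/-- The canonical basis vector `e_j`. -/
noncomputable def basisVec {N : ℕ∞} (j : Idx N) : Space N := lp.single 2 j (1 : ℂ)

/-- `M` is the matrix of the bounded operator `T` in the canonical basis: the `j`-th column of `M`
is `T e_j`. A matrix has at most one such `T`, and has one exactly if it is bounded. -/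
def IsMatrixOf {N : ℕ∞} (T : Space N →L[ℂ] Space N) (M : Matrix (Idx N) (Idx N) ℂ) : Prop :=
  ∀ i j : Idx N, T (basisVec j) i = M i j

/-- The `n`-th coordinate of a vector, read as `0` if `n` is not an index. -/
noncomputable def vecEntry {N : ℕ∞} (x : Idx N → ℂ) (n : ℕ) : ℂ :=
  open Classical in if h : 1 ≤ n ∧ (n : ℕ∞) ≤ N then x ⟨n, h⟩ else 0

/-- The entry in row `i` and column `j` of a matrix, read as `0` if `i` or `j` is not an index. -/
noncomputable def matEntry {N : ℕ∞} (M : Matrix (Idx N) (Idx N) ℂ) (i j : ℕ) : ℂ :=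
  vecEntry (fun k => vecEntry (M k) j) i

/-- Upper Hessenberg matrices: the `j`-th column lies in the span of `e_1, …, e_{j+1}`. -/
def IsHessenberg {N : ℕ∞} (M : Matrix (Idx N) (Idx N) ℂ) : Prop :=
  ∀ i j : Idx N, j.1 + 1 < i.1 → M i j = 0

/-- Irreducibility of a Hessenberg matrix: no subdiagonal entry vanishes. -/
def IsIrreducibleHessenberg {N : ℕ∞} (M : Matrix (Idx N) (Idx N) ℂ) : Prop :=
  IsHessenberg M ∧ ∀ i j : Idx N, i.1 = j.1 + 1 → M i j ≠ 0

/-- Para-tridiagonal matrices: five-diagonal matrices with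
`c_{2k,2k+2} = c_{2k+1,2k-1} = 0` for all `k ≥ 1`. -/
def IsParaTridiagonal {N : ℕ∞} (M : Matrix (Idx N) (Idx N) ℂ) : Prop :=
  (∀ i j : Idx N, (i.1 + 2 < j.1 ∨ j.1 + 2 < i.1) → M i j = 0) ∧
  (∀ i j : Idx N, Even i.1 → j.1 = i.1 + 2 → M i j = 0) ∧
  (∀ i j : Idx N, Odd i.1 → i.1 = j.1 + 2 → M i j = 0)

/-- `ρ_n = √(1 - |a_n|²)`. -/
noncomputable def rho (a : ℕ → ℂ) (n : ℕ) : ℂ := (Real.sqrt (1 - ‖a n‖ ^ 2) : ℝ)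

/-- The entries `c_{i,j}`, `i, j ≥ 1`, of the infinite five-diagonal matrix `C(a)` of a sequence
`(a_n)`, `n ≥ 1`. The value `a 0` plays no role: it is replaced by `1`, so that the first two
rows `(-a_1, -ρ_1 a_2, ρ_1 ρ_2, 0, …)` and `(ρ_1, -conj a_1 a_2, conj a_1 ρ_2, 0, …)` follow the
pattern of the others. -/
noncomputable def fiveDiagEntry (a : ℕ → ℂ) (i j : ℕ) : ℂ :=
  let α : ℕ → ℂ := fun n => if n = 0 then 1 else a n
  if Odd i then
    if i = j + 1 then -rho a (i - 1) * α i
    else if i = j then -conj (α (i - 1)) * α i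
    else if j = i + 1 then -rho a i * α (i + 1)
    else if j = i + 2 then rho a i * rho a (i + 1)
    else 0
  else
    if i = j + 2 then rho a (i - 2) * rho a (i - 1)
    else if i = j + 1 then conj (α (i - 2)) * rho a (i - 1)
    else if i = j then -conj (α (i - 1)) * α i
    else if j = i + 1 then conj (α (i - 1)) * rho a i
    else 0

/-- The principal submatrix `C(a_1, …, a_N)` of order `N` of `C(a)`, which only depends on
`a_1, …, a_N`; for `N = ⊤`, the matrix `C(a)` itself. -/
noncomputable def fiveDiag (N : ℕ∞) (a : ℕ → ℂ) : Matrix (Idx N) (Idx N) ℂ :=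
  fun i j => fiveDiagEntry a i.1 j.1

/-- `τ_1 = 1` and `τ_n = ∏_{k=1}^{n-1} h_{k+1,k}` for `n ≥ 2`. -/
noncomputable def tau {N : ℕ∞} (H : Matrix (Idx N) (Idx N) ℂ) (n : ℕ) : ℂ :=
  ∏ k ∈ Finset.Ico 1 n, matEntry H (k + 1) k

/-- `a_n = - h_{1,n} / conj τ_n`. -/
noncomputable def schurParam {N : ℕ∞} (H : Matrix (Idx N) (Idx N) ℂ) (n : ℕ) : ℂ :=
  -(matEntry H 1 n / conj (tau H n))

/-- The recursion for the columns of `V`. In the sums, `matEntry` discards the terms in which an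
index is not between `1` and the order (so the truncated lower limit `i - 2` does no harm). -/
def ColumnRecursion {N : ℕ∞} (H C V : Matrix (Idx N) (Idx N) ℂ) : Prop :=
  (∀ i j : Idx N, j.1 ≤ 2 →
    V i j = conj (tau H j.1) / (‖tau H j.1‖ : ℂ) * (if i = j then 1 else 0)) ∧
  (∀ i j : Idx N, 3 ≤ j.1 → i.1 ≤ 2 * j.1 - 2 →
    V i j = 1 / matEntry H j.1 (j.1 - 1) *
      (∑ k ∈ Finset.Icc (i.1 - 2) (min (i.1 + 2) (2 * j.1 - 4)),
          matEntry C i.1 k * matEntry V k (j.1 - 1)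
        - ∑ k ∈ Finset.Icc (min i.1 ((i.1 + 3) / 2)) (j.1 - 1),
          matEntry H k (j.1 - 1) * matEntry V i.1 k)) ∧
  (∀ i j : Idx N, 3 ≤ j.1 → 2 * j.1 - 1 ≤ i.1 → V i j = 0)

end UnitaryHessenberg

open UnitaryHessenberg

/-!
The operator `U = TH` is unitary and maps `e_n` into the span of `e_1, …, e_{n+1}`, so its structure
is that of the orthogonal polynomials on the unit circle, here carried by vectors instead of
polynomials. Put `u_n = (τ_n / |τ_n|) e_n` (`phased`) and define vectors `w_n` (`reversed`) by
`w_1 = e_1` and `w_{n+1} = ρ_n w_n + conj a_n u_{n+1}`. By induction on `n`, the vector `w_n` spans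
the orthogonal complement of `U e_1, …, U e_{n-1}` in the span of `e_1, …, e_n` (`ReversedSpec`).
Since `U u_n` minus its component along `u_{n+1}` lies in that complement, this gives the Szegő
recurrence `U u_n = ρ_n u_{n+1} - a_n w_n` (`map_phased`) with `ρ_n = |h_{n+1,n}|`. Taking norms
yields `|a_n|² + |h_{n+1,n}|² = 1`, hence the claims about `|a_n|`.

The vectors `χ_{2k+1} = U^{-k} w_{2k+1}` and `χ_{2k+2} = U^{-k} u_{2k+2}` (`laurent`) are orthonormal,
and `χ_1, …, χ_{2j-2}` span a space containing `e_j`, so they form a Hilbert basis. The two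
recurrences express `U χ_j` through at most four of the `χ_i`, and the coefficients are the entries
of the five-diagonal matrix (`inner_map_laurent`). Therefore the unitary operator of coordinates
with respect to `χ`, whose matrix is `v_{i,j} = ⟨χ_i, e_j⟩`, conjugates `H` to `C`; the recursion for
its columns compares two expansions of `⟨χ_i, U e_{j-1}⟩` (`columnRecursion`).

For an eigenvector `x` with eigenvalue `λ`, the recurrences determine the numbers `⟨u_n, x⟩` and
`⟨w_n, x⟩` from the first coordinate `x_1`, so eigenvectors have `x_1 ≠ 0` and eigenspaces are lines.
If `x_1` is real, they also give `λ^{n-1} ⟨u_n, x⟩ = conj ⟨w_n, x⟩` (`inner_phased_eq`), which is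
the stated relation between the coordinates of `x` along `e` and along `χ`.
-/

namespace UnitaryHessenberg

open scoped InnerProductSpace

/-! ### Padded orthonormal sequences -/

variable {E : Type*} [NormedAddCommGroup E] [InnerProductSpace ℂ E]

/-- A sequence of vectors that is orthonormal on the indices `1, …, N` and vanishes elsewhere.
Working with vectors indexed by `ℕ` and padded by zeros makes every recurrence below valid
at the boundary as well. -/
def OrthoSeq (N : ℕ∞) (f : ℕ → E) : Prop :=
  ∀ i j, ⟪f i, f j⟫_ℂ = if i = j ∧ 1 ≤ i ∧ (i : ℕ∞) ≤ N then 1 else 0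

/-- The span of the vectors `f 0, …, f m`. -/
def initSpan (f : ℕ → E) (m : ℕ) : Submodule ℂ E := Submodule.span ℂ (f '' Set.Iic m)

theorem mem_initSpan {f : ℕ → E} {n m : ℕ} (h : n ≤ m) : f n ∈ initSpan f m :=
  Submodule.subset_span ⟨n, h, rfl⟩

theorem initSpan_mono (f : ℕ → E) {n m : ℕ} (h : n ≤ m) : initSpan f n ≤ initSpan f m :=
  Submodule.span_mono (Set.image_mono (Set.Iic_subset_Iic.2 h))

theorem initSpan_le {f : ℕ → E} {m : ℕ} {S : Submodule ℂ E} (h : ∀ k ≤ m, f k ∈ S) :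
    initSpan f m ≤ S := by
  refine Submodule.span_le.2 ?_
  rintro _ ⟨k, hk, rfl⟩
  exact h k hk

theorem OrthoSeq.eq_zero {N : ℕ∞} {f : ℕ → E} (hf : OrthoSeq N f) {i : ℕ}
    (hi : ¬(1 ≤ i ∧ (i : ℕ∞) ≤ N)) : f i = 0 := by
  have := hf i i
  rw [if_neg (by tauto)] at this
  exact inner_self_eq_zero.1 this

theorem OrthoSeq.inner_self {N : ℕ∞} {f : ℕ → E} (hf : OrthoSeq N f) {i : ℕ}
    (h1 : 1 ≤ i) (hi : (i : ℕ∞) ≤ N) : ⟪f i, f i⟫_ℂ = 1 := by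
  rw [hf, if_pos ⟨rfl, h1, hi⟩]

theorem OrthoSeq.inner_ne {N : ℕ∞} {f : ℕ → E} (hf : OrthoSeq N f) {i j : ℕ}
    (h : i ≠ j) : ⟪f i, f j⟫_ℂ = 0 := by
  rw [hf, if_neg (by tauto)]

theorem OrthoSeq.inner_eq_zero {N : ℕ∞} {f : ℕ → E} (hf : OrthoSeq N f) {m n : ℕ} (h : m < n)
    {v : E} (hv : v ∈ initSpan f m) : ⟪f n, v⟫_ℂ = 0 := by
  have : initSpan f m ≤ (ℂ ∙ f n)ᗮ := initSpan_le fun k hk =>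
    Submodule.mem_orthogonal_singleton_iff_inner_right.2 (hf.inner_ne (by omega))
  exact Submodule.mem_orthogonal_singleton_iff_inner_right.1 (this hv)

theorem OrthoSeq.sum_inner {N : ℕ∞} {f : ℕ → E} (hf : OrthoSeq N f) {m : ℕ}
    {v : E} (hv : v ∈ initSpan f m) : v = ∑ k ∈ Finset.range (m + 1), ⟪f k, v⟫_ℂ • f k := by
  induction hv using Submodule.span_induction with
  | mem x hx =>
    obtain ⟨k, hk, rfl⟩ := hx
    rw [Finset.sum_eq_single_of_mem k (by simpa [Nat.lt_succ_iff] using hk)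
      fun l _ hl => by rw [hf.inner_ne hl, zero_smul]]
    by_cases h : 1 ≤ k ∧ (k : ℕ∞) ≤ N
    · rw [hf.inner_self h.1 h.2, one_smul]
    · rw [hf.eq_zero h, smul_zero]
  | zero => simp
  | add x y _ _ hx hy =>
    simp only [inner_add_right, add_smul, Finset.sum_add_distrib]
    rw [← hx, ← hy]
  | smul c x _ hx =>
    simp only [inner_smul_right, mul_smul, ← Finset.smul_sum]
    rw [← hx]

/-! ### Szegő recurrences -/

theorem matEntry_eq_zero {N : ℕ∞} (M : Matrix (Idx N) (Idx N) ℂ) {i j : ℕ}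
    (h : ¬((1 ≤ i ∧ (i : ℕ∞) ≤ N) ∧ 1 ≤ j ∧ (j : ℕ∞) ≤ N)) : matEntry M i j = 0 := by
  unfold matEntry vecEntry
  split_ifs <;> tauto

theorem matEntry_coe {N : ℕ∞} (M : Matrix (Idx N) (Idx N) ℂ) (i j : Idx N) :
    matEntry M i.1 j.1 = M i j := by
  simp [matEntry, vecEntry, i.2, j.2]

variable {N : ℕ∞}

/-- The vectors `u_n = (τ_n / |τ_n|) e_n`: the basis vectors with the phases of the orthonormal
polynomials with positive leading coefficients, applied to `e_1`. -/
noncomputable def phased (H : Matrix (Idx N) (Idx N) ℂ) (e : ℕ → E) (n : ℕ) : E :=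
  (tau H n / (‖tau H n‖ : ℂ)) • e n

/-- The vectors `w_n` of the reversed orthonormal polynomials, defined by the Szegő recurrence
`w_{n+1} = ρ_n w_n + conj a_n u_{n+1}`. As `a_0 = 0` and `ρ_0 = 1` for the junk index `0`, the
initial value `w_0 = e_1` gives `w_1 = e_1`. -/
noncomputable def reversed (H : Matrix (Idx N) (Idx N) ℂ) (e : ℕ → E) : ℕ → E
  | 0 => e 1
  | n + 1 => rho (schurParam H) n • reversed H e n +
      conj (schurParam H n) • phased H e (n + 1)

theorem tau_one (H : Matrix (Idx N) (Idx N) ℂ) : tau H 1 = 1 := by simp [tau]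

theorem tau_succ (H : Matrix (Idx N) (Idx N) ℂ) {n : ℕ} (hn : 1 ≤ n) :
    tau H (n + 1) = tau H n * matEntry H (n + 1) n := by
  rw [tau, Finset.prod_Ico_succ_top hn, tau]

theorem schurParam_eq_zero (H : Matrix (Idx N) (Idx N) ℂ) {n : ℕ}
    (h : ¬(1 ≤ n ∧ (n : ℕ∞) ≤ N)) : schurParam H n = 0 := by
  rw [schurParam, matEntry_eq_zero H (by tauto)]; simp

theorem phased_one (H : Matrix (Idx N) (Idx N) ℂ) (e : ℕ → E) : phased H e 1 = e 1 := by
  simp [phased, tau_one]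

theorem reversed_one (H : Matrix (Idx N) (Idx N) ℂ) (e : ℕ → E) : reversed H e 1 = e 1 := by
  simp [reversed, schurParam_eq_zero H (n := 0) (by simp), rho]

theorem phased_mem (H : Matrix (Idx N) (Idx N) ℂ) (e : ℕ → E) {n m : ℕ} (h : n ≤ m) :
    phased H e n ∈ initSpan e m :=
  Submodule.smul_mem _ _ (mem_initSpan h)

variable [CompleteSpace E] {H : Matrix (Idx N) (Idx N) ℂ} {e : ℕ → E} {U : E →L[ℂ] E}

/-- The unitary operator `U` is represented by the irreducible Hessenberg matrix `H` with respect
to the orthonormal family `e 1, e 2, …`. -/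
structure IsHessenbergRep (H : Matrix (Idx N) (Idx N) ℂ) (e : ℕ → E) (U : E →L[ℂ] E) : Prop where
  orth : OrthoSeq N e
  unitary : U ∈ unitary (E →L[ℂ] E)
  map_e : ∀ j, U (e j) = ∑ k ∈ Finset.range (j + 2), matEntry H k j • e k
  subdiag_ne : ∀ n, 1 ≤ n → ((n + 1 : ℕ) : ℕ∞) ≤ N → matEntry H (n + 1) n ≠ 0

theorem star_apply_apply (hU : U ∈ unitary (E →L[ℂ] E)) (x : E) : star U (U x) = x := by
  rw [← mul_apply_eq_comp, Unitary.star_mul_self_of_mem hU,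
    one_apply_eq_self]

theorem apply_star_apply (hU : U ∈ unitary (E →L[ℂ] E)) (x : E) : U (star U x) = x := by
  rw [← mul_apply_eq_comp, Unitary.mul_star_self_of_mem hU,
    one_apply_eq_self]

theorem inner_star_left (U : E →L[ℂ] E) (x y : E) : ⟪star U x, y⟫_ℂ = ⟪x, U y⟫_ℂ := by
  rw [ContinuousLinearMap.star_eq_adjoint, ContinuousLinearMap.adjoint_inner_left]

theorem inner_apply_apply (hU : U ∈ unitary (E →L[ℂ] E)) (x y : E) :
    ⟪U x, U y⟫_ℂ = ⟪x, y⟫_ℂ := by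
  rw [← inner_star_left, star_apply_apply hU]

namespace IsHessenbergRep

variable (S : IsHessenbergRep H e U)
include S

theorem tau_ne {n : ℕ} (hn : (n : ℕ∞) ≤ N) : tau H n ≠ 0 := by
  refine Finset.prod_ne_zero_iff.2 fun k hk => ?_
  rw [Finset.mem_Ico] at hk
  exact S.subdiag_ne k hk.1 (le_trans (by exact_mod_cast hk.2) hn)

theorem norm_tau_ne {n : ℕ} (hn : (n : ℕ∞) ≤ N) : (‖tau H n‖ : ℂ) ≠ 0 := by
  simpa using S.tau_ne hn

theorem phase_mul_conj {n : ℕ} (hn : (n : ℕ∞) ≤ N) :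
    tau H n / (‖tau H n‖ : ℂ) * conj (tau H n / (‖tau H n‖ : ℂ)) = 1 := by
  rw [Complex.mul_conj', norm_div, Complex.norm_real, norm_norm,
    div_self (norm_ne_zero_iff.2 (S.tau_ne hn))]
  simp

theorem phased_eq_zero {n : ℕ} (hn : ¬(1 ≤ n ∧ (n : ℕ∞) ≤ N)) : phased H e n = 0 := by
  rw [phased, S.orth.eq_zero hn, smul_zero]

theorem phased_inner_self {n : ℕ} (h1 : 1 ≤ n) (hn : (n : ℕ∞) ≤ N) :
    ⟪phased H e n, phased H e n⟫_ℂ = 1 := by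
  rw [phased, inner_smul_left, inner_smul_right, S.orth.inner_self h1 hn, mul_one, mul_comm,
    S.phase_mul_conj hn]

theorem phased_inner_eq_zero {m n : ℕ} (h : m < n) {v : E} (hv : v ∈ initSpan e m) :
    ⟪phased H e n, v⟫_ℂ = 0 := by
  rw [phased, inner_smul_left, S.orth.inner_eq_zero h hv, mul_zero]

theorem map_initSpan {m : ℕ} {v : E} (hv : v ∈ initSpan e m) : U v ∈ initSpan e (m + 1) := by
  have : initSpan e m ≤ (initSpan e (m + 1)).comap (U : E →ₗ[ℂ] E) := initSpan_le fun k hk => by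
    change U (e k) ∈ initSpan e (m + 1)
    rw [S.map_e]
    refine Submodule.sum_mem _ fun l hl => Submodule.smul_mem _ _ (mem_initSpan ?_)
    rw [Finset.mem_range] at hl; omega
  exact this hv

theorem pow_map_initSpan {m : ℕ} {v : E} (hv : v ∈ initSpan e m) (r : ℕ) :
    (U ^ r) v ∈ initSpan e (m + r) := by
  induction r with
  | zero => simpa using hv
  | succ r ih =>
    rw [pow_succ', mul_apply_eq_comp]
    exact S.map_initSpan ih

/-- The component of `U u_n` along `u_{n+1}` is `|h_{n+1,n}|`; the rest lies in the span of
`e_1, …, e_n`. -/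
theorem map_phased_sub_mem {n : ℕ} (h1 : 1 ≤ n) (hn : (n : ℕ∞) ≤ N) :
    U (phased H e n) - (‖matEntry H (n + 1) n‖ : ℂ) • phased H e (n + 1) ∈ initSpan e n := by
  have key : U (phased H e n) - (‖matEntry H (n + 1) n‖ : ℂ) • phased H e (n + 1) =
      (tau H n / (‖tau H n‖ : ℂ)) • ∑ k ∈ Finset.range (n + 1), matEntry H k n • e k := by
    rw [phased, map_smul, S.map_e, Finset.sum_range_succ _ (n + 1), smul_add, phased, smul_smul,
      smul_smul, tau_succ H h1, norm_mul, add_sub_assoc, ← sub_smul]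
    by_cases h0 : matEntry H (n + 1) n = 0
    · simp [h0]
    · have : (‖matEntry H (n + 1) n‖ : ℂ) ≠ 0 := by simpa using h0
      have := S.norm_tau_ne hn
      rw [add_eq_left.2]
      convert zero_smul ℂ _ using 2
      push_cast
      field_simp
      ring
  rw [key]
  refine Submodule.smul_mem _ _ (Submodule.sum_mem _ fun l hl =>
    Submodule.smul_mem _ _ (mem_initSpan ?_))
  rw [Finset.mem_range] at hl; omega

end IsHessenbergRep

/-- The properties of `w_n` carried along the induction: `w_n` spans the orthogonal complement of
`U e_1, …, U e_{n-1}` in the span of `e_1, …, e_n`, and it is normalized by `⟨e_1, w_n⟩ = |τ_n|`. -/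
structure ReversedSpec (H : Matrix (Idx N) (Idx N) ℂ) (e : ℕ → E) (U : E →L[ℂ] E) (n : ℕ) :
    Prop where
  mem : reversed H e n ∈ initSpan e n
  orth : ∀ j < n, ⟪U (e j), reversed H e n⟫_ℂ = 0
  inner_self : ⟪reversed H e n, reversed H e n⟫_ℂ = 1
  inner_one : ⟪e 1, reversed H e n⟫_ℂ = (‖tau H n‖ : ℂ)
  unique : ∀ v ∈ initSpan e n, (∀ j < n, ⟪U (e j), v⟫_ℂ = 0) →
    v = ⟪reversed H e n, v⟫_ℂ • reversed H e n

namespace IsHessenbergRep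

variable (S : IsHessenbergRep H e U)
include S

theorem map_phased_of_spec {n : ℕ} (h1 : 1 ≤ n) (hn : (n : ℕ∞) ≤ N) (R : ReversedSpec H e U n) :
    U (phased H e n) = (‖matEntry H (n + 1) n‖ : ℂ) • phased H e (n + 1) -
      schurParam H n • reversed H e n := by
  have hv := S.map_phased_sub_mem h1 hn
  have hort : ∀ j < n, ⟪U (e j),
      U (phased H e n) - (‖matEntry H (n + 1) n‖ : ℂ) • phased H e (n + 1)⟫_ℂ = 0 := by
    intro j hj
    rw [inner_sub_right, inner_apply_apply S.unitary, phased, inner_smul_right,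
      S.orth.inner_ne hj.ne, inner_smul_right, ← inner_conj_symm,
      S.phased_inner_eq_zero (Nat.lt_succ_self n)
        (initSpan_mono e hj (S.map_initSpan (mem_initSpan le_rfl)))]
    simp
  have hu := R.unique _ hv hort
  set c := ⟪reversed H e n, U (phased H e n) -
    (‖matEntry H (n + 1) n‖ : ℂ) • phased H e (n + 1)⟫_ℂ
  have hc : c = -schurParam H n := by
    -- compare the first coordinates
    have h := congrArg (fun v => ⟪e 1, v⟫_ℂ) hu
    simp only [inner_sub_right, inner_smul_right, R.inner_one] at h
    rw [phased, phased, inner_smul_right, S.orth.inner_ne (by omega), map_smul, inner_smul_right,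
      S.map_e, inner_sum, Finset.sum_eq_single_of_mem 1 (by simp)
        fun l _ hl => by rw [inner_smul_right, S.orth.inner_ne hl.symm, mul_zero],
      inner_smul_right] at h
    have h1N : ((1 : ℕ) : ℕ∞) ≤ N := le_trans (by exact_mod_cast h1) hn
    rw [S.orth.inner_self le_rfl h1N, mul_zero, mul_zero, sub_zero, mul_one] at h
    have ht := S.norm_tau_ne hn
    have ht' : conj (tau H n) ≠ 0 := by simpa using S.tau_ne hn
    have hm : tau H n * conj (tau H n) = (‖tau H n‖ : ℂ) ^ 2 := Complex.mul_conj' _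
    rw [schurParam, neg_neg, eq_div_iff ht']
    field_simp at h
    apply mul_left_cancel₀ (pow_ne_zero 2 ht)
    linear_combination (-conj (tau H n)) * h + matEntry H 1 n * hm
  rw [hc] at hu
  rw [← sub_eq_zero] at hu ⊢
  rw [← hu]; simp only [neg_smul]; abel

theorem norm_sq_add_of_spec {n : ℕ} (h1 : 1 ≤ n) (hn : (n : ℕ∞) ≤ N) (R : ReversedSpec H e U n) :
    ‖matEntry H (n + 1) n‖ ^ 2 + ‖schurParam H n‖ ^ 2 = 1 := by
  have h := inner_apply_apply S.unitary (phased H e n) (phased H e n)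
  have hz := S.phased_inner_eq_zero (Nat.lt_succ_self n) R.mem
  have hz' : ⟪reversed H e n, phased H e (n + 1)⟫_ℂ = 0 := by
    rw [← inner_conj_symm, hz, map_zero]
  have hself : (‖matEntry H (n + 1) n‖ : ℂ) * ⟪phased H e (n + 1), phased H e (n + 1)⟫_ℂ =
      (‖matEntry H (n + 1) n‖ : ℂ) := by
    by_cases hN : ((n + 1 : ℕ) : ℕ∞) ≤ N
    · rw [S.phased_inner_self (by omega) hN, mul_one]
    · rw [matEntry_eq_zero H (by tauto)]; simp
  rw [S.phased_inner_self h1 hn, S.map_phased_of_spec h1 hn R] at h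
  simp only [inner_sub_left, inner_sub_right, inner_smul_left, inner_smul_right, hz, hz',
    R.inner_self, hself, Complex.conj_ofReal] at h
  have hm : schurParam H n * conj (schurParam H n) = (‖schurParam H n‖ : ℂ) ^ 2 :=
    Complex.mul_conj' _
  have : ((‖matEntry H (n + 1) n‖ ^ 2 + ‖schurParam H n‖ ^ 2 : ℝ) : ℂ) = 1 := by
    push_cast
    linear_combination h - hm
  exact_mod_cast this

theorem rho_of_spec {n : ℕ} (h1 : 1 ≤ n) (hn : (n : ℕ∞) ≤ N) (R : ReversedSpec H e U n) :
    rho (schurParam H) n = (‖matEntry H (n + 1) n‖ : ℂ) := by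
  rw [rho, ← S.norm_sq_add_of_spec h1 hn R, add_sub_cancel_right, Real.sqrt_sq (norm_nonneg _)]

/-- In the span of `e_1, …, e_{n+1}`, the complement of `U e_1, …, U e_{n-1}` is spanned by `w_n`
and `u_{n+1}`, so the complement of `U e_1, …, U e_n` is the line orthogonal to
`U u_n = ρ_n u_{n+1} - a_n w_n` in that plane. -/
theorem reversedSpec_succ {n : ℕ} (h1 : 1 ≤ n) (hn : ((n + 1 : ℕ) : ℕ∞) ≤ N)
    (R : ReversedSpec H e U n) : ReversedSpec H e U (n + 1) := by
  have hn' : (n : ℕ∞) ≤ N := le_trans (by exact_mod_cast n.le_succ) hn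
  have hρ := S.rho_of_spec h1 hn' R
  have hsq := S.norm_sq_add_of_spec h1 hn' R
  have hmap := S.map_phased_of_spec h1 hn' R
  have hh : (‖matEntry H (n + 1) n‖ : ℂ) ≠ 0 := by simpa using S.subdiag_ne n h1 hn
  rw [← hρ] at hmap hh
  have hρc : conj (rho (schurParam H) n) = rho (schurParam H) n := by
    rw [rho, Complex.conj_ofReal]
  have hsqC : rho (schurParam H) n ^ 2 + schurParam H n * conj (schurParam H n) = 1 := by
    rw [hρ, Complex.mul_conj']; exact_mod_cast hsq
  set r := rho (schurParam H) n
  set a := schurParam H n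
  set w := reversed H e n
  set u := phased H e (n + 1) with hu
  have hw : reversed H e (n + 1) = r • w + conj a • u := rfl
  have huw : ⟪u, w⟫_ℂ = 0 := S.phased_inner_eq_zero (Nat.lt_succ_self n) R.mem
  have hwu : ⟪w, u⟫_ℂ = 0 := by rw [← inner_conj_symm, huw, map_zero]
  have huu : ⟪u, u⟫_ℂ = 1 := S.phased_inner_self (by omega) hn
  have hww : ⟪w, w⟫_ℂ = 1 := R.inner_self
  have hUu : ∀ j < n, ⟪U (e j), u⟫_ℂ = 0 := fun j hj => by
    rw [← inner_conj_symm, S.phased_inner_eq_zero (Nat.lt_succ_self n)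
      (initSpan_mono e hj (S.map_initSpan (mem_initSpan le_rfl))), map_zero]
  -- orthogonality to `U e_n` and to `U u_n` are the same
  have hphase : ∀ v, ⟪U (e n), v⟫_ℂ = 0 ↔ ⟪r • u - a • w, v⟫_ℂ = 0 := fun v => by
    have : tau H n / (‖tau H n‖ : ℂ) ≠ 0 := div_ne_zero (S.tau_ne hn') (S.norm_tau_ne hn')
    rw [← hmap, phased, map_smul, inner_smul_left, mul_eq_zero, map_eq_zero, or_iff_right this]
  refine ⟨?_, ?_, ?_, ?_, ?_⟩
  · rw [hw]
    exact add_mem (Submodule.smul_mem _ _ (initSpan_mono e n.le_succ R.mem))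
      (Submodule.smul_mem _ _ (phased_mem H e le_rfl))
  · intro j hj
    rw [hw]
    rcases Nat.lt_succ_iff_lt_or_eq.1 hj with hj | rfl
    · rw [inner_add_right, inner_smul_right, inner_smul_right, R.orth j hj, hUu j hj]; simp
    · rw [hphase]
      simp only [inner_sub_left, inner_add_right, inner_smul_left, inner_smul_right, huw, hwu,
        huu, hww, hρc]
      ring
  · rw [hw]
    simp only [inner_add_left, inner_add_right, inner_smul_left, inner_smul_right, huw, hwu,
        huu, hww, hρc, Complex.conj_conj]
    linear_combination hsqC
  · rw [hw, inner_add_right, inner_smul_right, inner_smul_right, R.inner_one, hu, phased,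
      inner_smul_right, S.orth.inner_ne (by omega), hρ, tau_succ H h1, norm_mul]
    push_cast; ring
  · intro v hv hvo
    -- split off the component along `e_{n+1}`
    have hsum := S.orth.sum_inner hv
    rw [Finset.sum_range_succ] at hsum
    set v' := ∑ k ∈ Finset.range (n + 1), ⟪e k, v⟫_ℂ • e k
    have hv' : v' ∈ initSpan e n := Submodule.sum_mem _ fun l hl =>
      Submodule.smul_mem _ _ (mem_initSpan (Nat.lt_succ_iff.1 (Finset.mem_range.1 hl)))
    obtain ⟨c, hc⟩ : ∃ c : ℂ, v = v' + c • u := by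
      refine ⟨⟪e (n + 1), v⟫_ℂ * conj (tau H (n + 1) / (‖tau H (n + 1)‖ : ℂ)), ?_⟩
      rw [hu, phased, smul_smul, mul_assoc, mul_comm (conj _), S.phase_mul_conj hn, mul_one]
      exact hsum
    have hv'o : ∀ j < n, ⟪U (e j), v'⟫_ℂ = 0 := fun j hj => by
      have := hvo j (by omega)
      rwa [hc, inner_add_right, inner_smul_right, hUu j hj, mul_zero, add_zero] at this
    have hd := R.unique v' hv' hv'o
    set d := ⟪reversed H e n, v'⟫_ℂ
    rw [hd] at hc
    change v = d • w + c • u at hc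
    have hn0 := (hphase v).1 (hvo n (Nat.lt_succ_self n))
    rw [hc] at hn0
    simp only [inner_sub_left, inner_add_right, inner_smul_left, inner_smul_right, huw, hwu,
        huu, hww, hρc] at hn0
    rw [hw, hc]
    simp only [inner_add_left, inner_add_right, inner_smul_left, inner_smul_right, huw, hwu,
        huu, hww, hρc, Complex.conj_conj, smul_add, smul_smul]
    congr 2
    · linear_combination (-d) * hsqC - a * hn0
    · apply mul_left_cancel₀ hh
      linear_combination (1 - a * conj a) * hn0 - d * conj a * hsqC

theorem reversedSpec {n : ℕ} (h1 : 1 ≤ n) (hn : (n : ℕ∞) ≤ N) : ReversedSpec H e U n := by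
  induction n, h1 using Nat.le_induction with
  | base =>
    have he0 : e 0 = 0 := S.orth.eq_zero (by simp)
    refine ⟨?_, ?_, ?_, ?_, ?_⟩
    · rw [reversed_one]; exact mem_initSpan le_rfl
    · intro j hj
      obtain rfl : j = 0 := by omega
      rw [he0, map_zero, inner_zero_left]
    · rw [reversed_one, S.orth.inner_self le_rfl hn]
    · rw [reversed_one, S.orth.inner_self le_rfl hn, tau_one]; simp
    · intro v hv _
      have h := S.orth.sum_inner hv
      simp only [Finset.sum_range_succ, Finset.sum_range_zero, he0, smul_zero, zero_add] at h
      rw [reversed_one]; exact h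
  | succ n h1 ih =>
    exact S.reversedSpec_succ h1 hn (ih (le_trans (by exact_mod_cast n.le_succ) hn))

theorem norm_sq_add {n : ℕ} (h1 : 1 ≤ n) (hn : (n : ℕ∞) ≤ N) :
    ‖matEntry H (n + 1) n‖ ^ 2 + ‖schurParam H n‖ ^ 2 = 1 :=
  S.norm_sq_add_of_spec h1 hn (S.reversedSpec h1 hn)

theorem rho_eq {n : ℕ} (h1 : 1 ≤ n) (hn : (n : ℕ∞) ≤ N) :
    rho (schurParam H) n = (‖matEntry H (n + 1) n‖ : ℂ) :=
  S.rho_of_spec h1 hn (S.reversedSpec h1 hn)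

theorem norm_schurParam_lt {n : ℕ} (h1 : 1 ≤ n) (hn : ((n + 1 : ℕ) : ℕ∞) ≤ N) :
    ‖schurParam H n‖ < 1 := by
  have h := S.norm_sq_add h1 (le_trans (by exact_mod_cast n.le_succ) hn)
  have := norm_pos_iff.2 (S.subdiag_ne n h1 hn)
  nlinarith [norm_nonneg (schurParam H n)]

theorem norm_schurParam_last {n : ℕ} (h1 : 1 ≤ n) (hn : (n : ℕ∞) = N) :
    ‖schurParam H n‖ = 1 := by
  have h := S.norm_sq_add h1 hn.le
  rw [matEntry_eq_zero H, norm_zero] at h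
  · nlinarith [norm_nonneg (schurParam H n)]
  · rw [← hn]; simp only [Nat.cast_le]; omega

theorem rho_ne {n : ℕ} (h1 : 1 ≤ n) (hn : ((n + 1 : ℕ) : ℕ∞) ≤ N) :
    rho (schurParam H) n ≠ 0 := by
  rw [S.rho_eq h1 (le_trans (by exact_mod_cast n.le_succ) hn)]
  simpa using S.subdiag_ne n h1 hn

theorem rho_sq {n : ℕ} (h1 : 1 ≤ n) (hn : (n : ℕ∞) ≤ N) :
    rho (schurParam H) n ^ 2 + schurParam H n * conj (schurParam H n) = 1 := by
  rw [S.rho_eq h1 hn, Complex.mul_conj']; exact_mod_cast S.norm_sq_add h1 hn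

/-- Beyond the order of the matrix, the reversed vectors vanish because `ρ_N = 0`. -/
theorem reversed_eq_zero {n : ℕ} (h1 : 1 ≤ n) (hn : N < (n : ℕ∞)) (hN : 1 ≤ N) :
    reversed H e n = 0 := by
  induction n, h1 using Nat.le_induction with
  | base => exact absurd hN (by simpa using hn)
  | succ n h1 ih =>
    rw [reversed, S.phased_eq_zero (n := n + 1) (fun h => hn.not_ge h.2), smul_zero, add_zero]
    rcases lt_or_ge N (n : ℕ∞) with h | h
    · rw [ih h, smul_zero]
    · rw [S.rho_eq h1 h, matEntry_eq_zero H (fun h => hn.not_ge h.1.2)]; simp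

/-- The Szegő recurrence for the vectors `u_n`. -/
theorem map_phased {n : ℕ} (h1 : 1 ≤ n) :
    U (phased H e n) = rho (schurParam H) n • phased H e (n + 1) -
      schurParam H n • reversed H e n := by
  by_cases hn : (n : ℕ∞) ≤ N
  · rw [S.map_phased_of_spec h1 hn (S.reversedSpec h1 hn), S.rho_eq h1 hn]
  · rw [S.phased_eq_zero (by tauto), S.phased_eq_zero (n := n + 1), schurParam_eq_zero H (by tauto)]
    · simp
    · intro h
      exact hn (le_trans (by exact_mod_cast n.le_succ) h.2)

end IsHessenbergRep

/-! ### The Laurent basis and the five-diagonal matrix -/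

/-- The vectors `χ_{2k+1} = U^{-k} w_{2k+1}` and `χ_{2k+2} = U^{-k} u_{2k+2}`: the orthonormal
Laurent polynomials for the ordering `1, z, z⁻¹, z², z⁻², …`, applied to `e_1`. -/
noncomputable def laurent (H : Matrix (Idx N) (Idx N) ℂ) (e : ℕ → E) (U : E →L[ℂ] E) (n : ℕ) : E :=
  star (U ^ ((n - 1) / 2)) (if Odd n then reversed H e n else phased H e n)

theorem laurent_odd (H : Matrix (Idx N) (Idx N) ℂ) (e : ℕ → E) (U : E →L[ℂ] E) (k : ℕ) :
    laurent H e U (2 * k + 1) = star (U ^ k) (reversed H e (2 * k + 1)) := by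
  rw [laurent, if_pos ⟨k, rfl⟩]
  congr 3; omega

theorem laurent_even (H : Matrix (Idx N) (Idx N) ℂ) (e : ℕ → E) (U : E →L[ℂ] E) (k : ℕ) :
    laurent H e U (2 * k + 2) = star (U ^ k) (phased H e (2 * k + 2)) := by
  rw [laurent, if_neg (by rw [Nat.odd_iff]; omega)]
  congr 3; omega

theorem laurent_one (H : Matrix (Idx N) (Idx N) ℂ) (e : ℕ → E) (U : E →L[ℂ] E) :
    laurent H e U 1 = e 1 := by
  have := laurent_odd H e U 0
  simpa [reversed_one] using this

theorem laurent_two (H : Matrix (Idx N) (Idx N) ℂ) (e : ℕ → E) (U : E →L[ℂ] E) :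
    laurent H e U 2 = phased H e 2 := by
  have := laurent_even H e U 0
  simpa using this

theorem apply_star_pow_succ (hU : U ∈ unitary (E →L[ℂ] E)) (k : ℕ) (x : E) :
    U (star (U ^ (k + 1)) x) = star (U ^ k) x := by
  rw [pow_succ, star_mul, mul_apply_eq_comp, apply_star_apply hU]

theorem star_pow_succ_apply (hU : U ∈ unitary (E →L[ℂ] E)) (k : ℕ) (x : E) :
    star (U ^ (k + 1)) (U x) = star (U ^ k) x := by
  rw [pow_succ', star_mul, mul_apply_eq_comp, star_apply_apply hU]

theorem apply_star_pow (hU : U ∈ unitary (E →L[ℂ] E)) (k : ℕ) (x : E) :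
    U (star (U ^ k) x) = star (U ^ k) (U x) := by
  rw [← apply_star_pow_succ hU k (U x), star_pow_succ_apply hU]

theorem star_pow_reversed (H : Matrix (Idx N) (Idx N) ℂ) (e : ℕ → E) (U : E →L[ℂ] E) (k : ℕ) :
    star (U ^ k) (reversed H e (2 * k + 2)) =
      rho (schurParam H) (2 * k + 1) • laurent H e U (2 * k + 1) +
        conj (schurParam H (2 * k + 1)) • laurent H e U (2 * k + 2) := by
  rw [laurent_odd, laurent_even, reversed, map_add, map_smul, map_smul]

namespace IsHessenbergRep

variable (S : IsHessenbergRep H e U)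
include S

theorem laurent_eq_zero (hN : 1 ≤ N) {n : ℕ} (hn : ¬(1 ≤ n ∧ (n : ℕ∞) ≤ N)) :
    laurent H e U n = 0 := by
  rw [laurent, S.phased_eq_zero hn]
  split_ifs with ho
  · rw [S.reversed_eq_zero ho.pos (not_le.1 fun h => hn ⟨ho.pos, h⟩) hN, map_zero]
  · rw [map_zero]

theorem laurent_inner_self {n : ℕ} (h1 : 1 ≤ n) (hn : (n : ℕ∞) ≤ N) :
    ⟪laurent H e U n, laurent H e U n⟫_ℂ = 1 := by
  rw [laurent, inner_apply_apply (Unitary.star_mem (pow_mem S.unitary _))]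
  split_ifs
  · exact (S.reversedSpec h1 hn).inner_self
  · exact S.phased_inner_self h1 hn

theorem pow_laurent_mem {n : ℕ} (h1 : 1 ≤ n) (hn : (n : ℕ∞) ≤ N) (d : ℕ) :
    (U ^ (d + (n - 1) / 2)) (laurent H e U n) ∈ initSpan e (n + d) := by
  rw [pow_add, mul_apply_eq_comp, laurent, apply_star_apply (pow_mem S.unitary _)]
  refine S.pow_map_initSpan ?_ d
  split_ifs
  · exact (S.reversedSpec h1 hn).mem
  · exact phased_mem H e le_rfl

/-- For `i < j`, the power of `U` that takes `χ_j` to `w_j` or `u_j` takes `χ_i` to a vector of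
`U (span (e_1, …, e_{j-1}))` or `span (e_1, …, e_{j-1})`, respectively. -/
theorem laurent_inner_eq_zero {i j : ℕ} (hi : 1 ≤ i) (hij : i < j) (hj : (j : ℕ∞) ≤ N) :
    ⟪laurent H e U j, laurent H e U i⟫_ℂ = 0 := by
  have hiN : (i : ℕ∞) ≤ N := le_trans (by exact_mod_cast hij.le) hj
  rcases Nat.even_or_odd' j with ⟨k, rfl | rfl⟩
  · obtain ⟨k, rfl⟩ : ∃ l, k = l + 1 := ⟨k - 1, by omega⟩
    rw [mul_add, mul_one] at hij hj ⊢
    rw [laurent_even, inner_star_left]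
    refine S.phased_inner_eq_zero (m := 2 * k + 1) (by omega) ?_
    have := S.pow_laurent_mem hi hiN (k - (i - 1) / 2)
    rw [Nat.sub_add_cancel (by omega)] at this
    exact initSpan_mono e (by omega) this
  · rw [laurent_odd, inner_star_left]
    have := S.pow_laurent_mem hi hiN (k - 1 - (i - 1) / 2)
    rw [Nat.sub_add_cancel (by omega)] at this
    have hv := initSpan_mono e (show _ ≤ 2 * k by omega) this
    have hle : initSpan e (2 * k) ≤ (ℂ ∙ star U (reversed H e (2 * k + 1)))ᗮ :=
      initSpan_le fun l hl => by
        rw [Submodule.mem_orthogonal_singleton_iff_inner_right, inner_star_left, ← inner_conj_symm,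
          (S.reversedSpec (by omega) hj).orth l (by omega), map_zero]
    have h0 := Submodule.mem_orthogonal_singleton_iff_inner_right.1 (hle hv)
    rw [inner_star_left, ← mul_apply_eq_comp, ← pow_succ', Nat.sub_add_cancel (by omega)] at h0
    exact h0

theorem laurent_orthoSeq (hN : 1 ≤ N) : OrthoSeq N (laurent H e U) := by
  intro i j
  by_cases hi : 1 ≤ i ∧ (i : ℕ∞) ≤ N
  swap
  · rw [S.laurent_eq_zero hN hi, inner_zero_left, if_neg (by tauto)]
  by_cases hj : 1 ≤ j ∧ (j : ℕ∞) ≤ N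
  swap
  · rw [S.laurent_eq_zero hN hj, inner_zero_right, if_neg (by rintro ⟨rfl, h⟩; exact hj h)]
  rcases lt_trichotomy i j with h | rfl | h
  · rw [← inner_conj_symm, S.laurent_inner_eq_zero hi.1 h hj.2, if_neg (by omega), map_zero]
  · rw [S.laurent_inner_self hi.1 hi.2, if_pos ⟨rfl, hi⟩]
  · rw [S.laurent_inner_eq_zero hj.1 h hi.2, if_neg (by omega)]

theorem star_pow_phased (k : ℕ) : star (U ^ k) (phased H e (2 * k + 3)) =
    rho (schurParam H) (2 * k + 3) • laurent H e U (2 * k + 4) -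
      schurParam H (2 * k + 3) • laurent H e U (2 * k + 3) := by
  have ho := laurent_odd H e U (k + 1)
  have he := laurent_even H e U (k + 1)
  rw [mul_add, mul_one] at ho he
  rw [ho, he, ← star_pow_succ_apply S.unitary, S.map_phased (by omega), map_sub, map_smul, map_smul]

theorem map_laurent_one : U (laurent H e U 1) =
    rho (schurParam H) 1 • laurent H e U 2 - schurParam H 1 • laurent H e U 1 := by
  rw [laurent_one, laurent_two, ← phased_one H e, S.map_phased le_rfl, reversed_one, phased_one]

theorem map_laurent_even (k : ℕ) : U (laurent H e U (2 * k + 2)) =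
    rho (schurParam H) (2 * k + 2) •
      (rho (schurParam H) (2 * k + 3) • laurent H e U (2 * k + 4) -
        schurParam H (2 * k + 3) • laurent H e U (2 * k + 3)) -
    schurParam H (2 * k + 2) •
      (rho (schurParam H) (2 * k + 1) • laurent H e U (2 * k + 1) +
        conj (schurParam H (2 * k + 1)) • laurent H e U (2 * k + 2)) := by
  rw [← S.star_pow_phased, ← star_pow_reversed, laurent_even, apply_star_pow S.unitary,
    S.map_phased (by omega), map_sub, map_smul, map_smul]

theorem map_laurent_odd (k : ℕ) : U (laurent H e U (2 * k + 3)) =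
    rho (schurParam H) (2 * k + 2) •
      (rho (schurParam H) (2 * k + 1) • laurent H e U (2 * k + 1) +
        conj (schurParam H (2 * k + 1)) • laurent H e U (2 * k + 2)) +
    conj (schurParam H (2 * k + 2)) •
      (rho (schurParam H) (2 * k + 3) • laurent H e U (2 * k + 4) -
        schurParam H (2 * k + 3) • laurent H e U (2 * k + 3)) := by
  have ho := laurent_odd H e U (k + 1)
  rw [mul_add, mul_one] at ho
  rw [← S.star_pow_phased, ← star_pow_reversed, ho, apply_star_pow_succ S.unitary,
    reversed, map_add, map_smul, map_smul]

/-- The matrix of `U` with respect to the vectors `χ_n` is the five-diagonal matrix. -/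
theorem inner_map_laurent (hN : 1 ≤ N) {i j : ℕ} (hi : 1 ≤ i) (hiN : (i : ℕ∞) ≤ N) (hj : 1 ≤ j) :
    ⟪laurent H e U i, U (laurent H e U j)⟫_ℂ = fiveDiagEntry (schurParam H) i j := by
  have hδ : ∀ m, ⟪laurent H e U i, laurent H e U m⟫_ℂ = if i = m then 1 else 0 := fun m => by
    rw [S.laurent_orthoSeq hN]; simp [hi, hiN]
  have ho : ∀ k, Odd (2 * k + 1) ∧ Odd (2 * k + 3) := fun k => by simp only [Nat.odd_iff]; omega
  have he : ∀ k, ¬Odd (2 * k + 2) ∧ ¬Odd (2 * k + 4) := fun k => by simp only [Nat.odd_iff]; omega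
  obtain rfl | ⟨k, hk⟩ : j = 1 ∨ ∃ k, j = 2 * k + 2 ∨ j = 2 * k + 3 := by
    by_cases h : j = 1
    · exact Or.inl h
    · exact Or.inr ⟨(j - 2) / 2, by omega⟩
  · rw [S.map_laurent_one]
    simp only [inner_sub_right, inner_smul_right, hδ, fiveDiagEntry, Nat.odd_iff]
    split_ifs <;> first | omega | (subst_vars; simp)
  -- columns `2 k + 2` and `2 k + 3` are supported on the rows `2 k + 1, …, 2 k + 4`
  by_cases hik : 2 * k + 1 ≤ i ∧ i ≤ 2 * k + 4
  · obtain rfl | rfl | rfl | rfl :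
        i = 2 * k + 1 ∨ i = 2 * k + 2 ∨ i = 2 * k + 3 ∨ i = 2 * k + 4 := by omega
    all_goals
      rcases hk with rfl | rfl
      · rw [S.map_laurent_even]
        simp only [inner_sub_right, inner_add_right, inner_smul_right, hδ, fiveDiagEntry]
        simp [ho, he]
        try ring
      · rw [S.map_laurent_odd]
        simp only [inner_sub_right, inner_add_right, inner_smul_right, hδ, fiveDiagEntry]
        simp [ho, he]
        try ring
  · have h0 : ∀ m, 2 * k + 1 ≤ m → m ≤ 2 * k + 4 → ⟪laurent H e U i, laurent H e U m⟫_ℂ = 0 :=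
      fun m h1 h2 => by rw [hδ, if_neg (by omega)]
    have hE : fiveDiagEntry (schurParam H) i j = 0 := by
      simp only [fiveDiagEntry, Nat.odd_iff]
      split_ifs <;> first | rfl | omega
    rw [hE]
    rcases hk with rfl | rfl
    · rw [S.map_laurent_even]
      simp only [inner_sub_right, inner_add_right, inner_smul_right]
      simp [h0]
    · rw [S.map_laurent_odd]
      simp only [inner_sub_right, inner_add_right, inner_smul_right]
      simp [h0]

theorem map_laurent_initSpan {m : ℕ} (hm : Even m) (hm0 : 1 ≤ m) (hN : 1 ≤ N) {v : E}
    (hv : v ∈ initSpan (laurent H e U) m) : U v ∈ initSpan (laurent H e U) (m + 2) := by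
  have : initSpan (laurent H e U) m ≤
      (initSpan (laurent H e U) (m + 2)).comap (U : E →ₗ[ℂ] E) := initSpan_le fun j hj => by
    change U (laurent H e U j) ∈ initSpan (laurent H e U) (m + 2)
    have hm' := Nat.even_iff.1 hm
    have hmem : ∀ l ≤ m + 2, ∀ c : ℂ, c • laurent H e U l ∈ initSpan (laurent H e U) (m + 2) :=
      fun l hl c => Submodule.smul_mem _ _ (mem_initSpan hl)
    obtain rfl | rfl | ⟨k, rfl | rfl⟩ :
        j = 0 ∨ j = 1 ∨ ∃ k, j = 2 * k + 2 ∨ j = 2 * k + 3 := by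
      by_cases h : j ≤ 1
      · omega
      · exact Or.inr (Or.inr ⟨(j - 2) / 2, by omega⟩)
    · rw [S.laurent_eq_zero hN (by simp), map_zero]; exact zero_mem _
    · rw [S.map_laurent_one]
      exact sub_mem (hmem _ (by omega) _) (hmem _ (by omega) _)
    · rw [S.map_laurent_even]
      exact sub_mem
        (Submodule.smul_mem _ _ (sub_mem (hmem _ (by omega) _) (hmem _ (by omega) _)))
        (Submodule.smul_mem _ _ (add_mem (hmem _ (by omega) _) (hmem _ (by omega) _)))
    · rw [S.map_laurent_odd]
      exact add_mem
        (Submodule.smul_mem _ _ (add_mem (hmem _ (by omega) _) (hmem _ (by omega) _)))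
        (Submodule.smul_mem _ _ (sub_mem (hmem _ (by omega) _) (hmem _ (by omega) _)))
  exact this hv

/-- Each `e_j` with `j ≥ 2` is a combination of `χ_1, …, χ_{2j-2}`, the span of the Laurent
monomials `z^{2-j}, …, z^{j-1}`. -/
theorem mem_initSpan_laurent (hN : 1 ≤ N) {j : ℕ} (hj : 1 ≤ j) :
    e (j + 1) ∈ initSpan (laurent H e U) (2 * j) := by
  induction j using Nat.strong_induction_on with
  | _ j ih =>
  by_cases hjN : ((j + 1 : ℕ) : ℕ∞) ≤ N
  swap
  · rw [S.orth.eq_zero (by tauto)]; exact zero_mem _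
  have hlow : ∀ k ≤ j, e k ∈ initSpan (laurent H e U) (2 * j) := fun k hk => by
    obtain rfl | rfl | ⟨l, rfl⟩ : k = 0 ∨ k = 1 ∨ ∃ l, k = l + 1 + 1 := by
      by_cases h : k ≤ 1
      · omega
      · exact Or.inr (Or.inr ⟨k - 2, by omega⟩)
    · rw [S.orth.eq_zero (by simp)]; exact zero_mem _
    · rw [← laurent_one H e U]; exact mem_initSpan (by omega)
    · exact initSpan_mono _ (by omega) (ih (l + 1) (by omega) (by omega))
  have hU : U (e j) ∈ initSpan (laurent H e U) (2 * j) := by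
    obtain rfl | ⟨l, rfl⟩ : j = 1 ∨ ∃ l, j = l + 1 + 1 := by
      by_cases h : j = 1
      · exact Or.inl h
      · exact Or.inr ⟨j - 2, by omega⟩
    · rw [← laurent_one H e U, S.map_laurent_one]
      exact sub_mem (Submodule.smul_mem _ _ (mem_initSpan le_rfl))
        (Submodule.smul_mem _ _ (mem_initSpan (by omega)))
    · exact S.map_laurent_initSpan (m := 2 * (l + 1)) (by simp) (by omega) hN (ih (l + 1) (by omega) (by omega))
  rw [S.map_e, Finset.sum_range_succ] at hU
  have hs : ∑ k ∈ Finset.range (j + 1), matEntry H k j • e k ∈ initSpan (laurent H e U) (2 * j) :=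
    Submodule.sum_mem _ fun k hk => Submodule.smul_mem _ _
      (hlow k (Nat.lt_succ_iff.1 (Finset.mem_range.1 hk)))
  have := (Submodule.add_mem_iff_right _ hs).1 hU
  exact ((initSpan (laurent H e U) (2 * j)).smul_mem_iff (S.subdiag_ne j hj hjN)).1 this

/-! ### Eigenvectors -/

/-- By the two recurrences, an eigenvector is determined by its first coordinate. -/
theorem eq_zero_of_eigen {z : ℂ} {x : E} (hx : U x = z • x) (hz : z ≠ 0)
    (htot : ∀ y : E, (∀ n, ⟪e n, y⟫_ℂ = 0) → y = 0) (h1 : ⟪e 1, x⟫_ℂ = 0) : x = 0 := by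
  have hsx : star U x = z⁻¹ • x := by
    rw [eq_inv_smul_iff₀ hz, ← map_smul, ← hx, star_apply_apply S.unitary]
  have key : ∀ n, ⟪phased H e (n + 1), x⟫_ℂ = 0 ∧ ⟪reversed H e (n + 1), x⟫_ℂ = 0 := by
    intro n
    induction n with
    | zero => rw [zero_add, phased_one, reversed_one]; exact ⟨h1, h1⟩
    | succ n ih =>
      have hp : ⟪phased H e (n + 1 + 1), x⟫_ℂ = 0 := by
        by_cases hn : ((n + 1 + 1 : ℕ) : ℕ∞) ≤ N
        · have h := congrArg (fun v => ⟪v, x⟫_ℂ) (S.map_phased (n := n + 1) (by omega))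
          simp only [inner_sub_left, inner_smul_left, ih.2, mul_zero, sub_zero] at h
          rw [← star_star U, inner_star_left, hsx, inner_smul_right, ih.1, mul_zero] at h
          exact (mul_eq_zero.1 h.symm).resolve_left
            ((map_ne_zero _).2 (S.rho_ne (by omega) hn))
        · rw [S.phased_eq_zero (by tauto), inner_zero_left]
      refine ⟨hp, ?_⟩
      rw [reversed, inner_add_left, inner_smul_left, inner_smul_left, ih.2, hp]; simp
  refine htot x fun n => ?_
  by_cases hn : 1 ≤ n ∧ (n : ℕ∞) ≤ N
  · obtain ⟨m, rfl⟩ : ∃ m, n = m + 1 := ⟨n - 1, by omega⟩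
    have h := (key m).1
    rw [phased, inner_smul_left] at h
    exact (mul_eq_zero.1 h).resolve_left
      ((map_ne_zero _).2 (div_ne_zero (S.tau_ne hn.2) (S.norm_tau_ne hn.2)))
  · rw [S.orth.eq_zero hn, inner_zero_left]

/-- For an eigenvector with real first coordinate, the coordinates along `u_{n+1}` and `w_{n+1}` are,
up to that coordinate, the conjugate values at `λ` of a polynomial of degree `n` and of its reversed
polynomial, and `|λ| = 1`. -/
theorem inner_phased_eq (hN : 1 ≤ N) {z : ℂ} {x : E} (hx : U x = z • x) (hz : ‖z‖ = 1)
    (h1 : (⟪e 1, x⟫_ℂ).im = 0) (n : ℕ) :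
    z ^ n * ⟪phased H e (n + 1), x⟫_ℂ = conj ⟪reversed H e (n + 1), x⟫_ℂ := by
  have hz0 : z ≠ 0 := norm_ne_zero_iff.1 (by rw [hz]; exact one_ne_zero)
  have hzz : z * conj z = 1 := by rw [Complex.mul_conj', hz]; simp
  have hsx : star U x = z⁻¹ • x := by
    rw [eq_inv_smul_iff₀ hz0, ← map_smul, ← hx, star_apply_apply S.unitary]
  induction n with
  | zero =>
    rw [zero_add, phased_one, reversed_one, Complex.conj_eq_iff_im.2 h1]; simp
  | succ n ih =>
    by_cases hn : ((n + 1 + 1 : ℕ) : ℕ∞) ≤ N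
    · have hn' : ((n + 1 : ℕ) : ℕ∞) ≤ N := le_trans (by exact_mod_cast (n + 1).le_succ) hn
      have hr := S.rho_ne (by omega) hn
      have hsq := S.rho_sq (n := n + 1) (by omega) hn'
      have h := congrArg (fun v => ⟪v, x⟫_ℂ) (S.map_phased (n := n + 1) (by omega))
      have hρ : conj (rho (schurParam H) (n + 1)) = rho (schurParam H) (n + 1) := by
        rw [rho, Complex.conj_ofReal]
      have hw : ⟪reversed H e (n + 1 + 1), x⟫_ℂ =
          rho (schurParam H) (n + 1) * ⟪reversed H e (n + 1), x⟫_ℂ +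
          schurParam H (n + 1) * ⟪phased H e (n + 1 + 1), x⟫_ℂ := by
        rw [reversed, inner_add_left, inner_smul_left, inner_smul_left, hρ, Complex.conj_conj]
      simp only [inner_sub_left, inner_smul_left, hρ] at h
      rw [← star_star U, inner_star_left, hsx, inner_smul_right, inv_mul_eq_iff_eq_mul₀ hz0] at h
      rw [hw, map_add, map_mul, map_mul, hρ]
      have ih' := congrArg conj ih
      rw [map_mul, map_pow, Complex.conj_conj] at ih'
      have h' := congrArg conj h
      simp only [map_mul, map_sub, hρ, Complex.conj_conj] at h'
      have hpow : z ^ n * conj z ^ n = 1 := by rw [← mul_pow, hzz, one_pow]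
      generalize ⟪phased H e (n + 1), x⟫_ℂ = X at *
      generalize ⟪reversed H e (n + 1), x⟫_ℂ = W at *
      generalize ⟪phased H e (n + 1 + 1), x⟫_ℂ = X' at *
      generalize rho (schurParam H) (n + 1) = r at *
      generalize schurParam H (n + 1) = a at *
      -- all terms can be expressed through `X'` and `W`; the identity follows from `ρ² + |a|² = 1`
      apply mul_left_cancel₀ hr
      linear_combination (-z ^ n) * h + ih - conj W * hsq + z * conj a * h' +
        conj a * (r * conj X' - a * conj W) * hzz - z ^ (n + 1) * conj a * ih' +
        z * conj a * conj X * hpow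
    · rw [S.phased_eq_zero (by tauto), inner_zero_left, mul_zero,
        S.reversed_eq_zero (by omega) (not_le.1 hn) hN, inner_zero_left, map_zero]

/-! ### Coordinates with respect to the Laurent basis -/

theorem inner_eq_zero_of_laurent (hN : 1 ≤ N) {y : E} (h : ∀ n, ⟪laurent H e U n, y⟫_ℂ = 0)
    (n : ℕ) : ⟪e n, y⟫_ℂ = 0 := by
  obtain rfl | rfl | ⟨l, rfl⟩ : n = 0 ∨ n = 1 ∨ ∃ l, n = l + 1 + 1 := by
    by_cases h : n ≤ 1
    · omega
    · exact Or.inr (Or.inr ⟨n - 2, by omega⟩)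
  · rw [S.orth.eq_zero (by simp), inner_zero_left]
  · rw [← laurent_one H e U]; exact h 1
  · have hle : initSpan (laurent H e U) (2 * (l + 1)) ≤ (ℂ ∙ y)ᗮ := initSpan_le fun k _ =>
      Submodule.mem_orthogonal_singleton_iff_inner_left.2 (h k)
    exact Submodule.mem_orthogonal_singleton_iff_inner_left.1
      (hle (S.mem_initSpan_laurent hN (by omega)))

theorem eq_smul_laurent {j : ℕ} (hj : j = 1 ∨ j = 2) (hjN : (j : ℕ∞) ≤ N) :
    e j = (conj (tau H j) / (‖tau H j‖ : ℂ)) • laurent H e U j := by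
  have h : laurent H e U j = phased H e j := by
    rcases hj with rfl | rfl
    · rw [laurent_one, phased_one]
    · rw [laurent_two]
  have hp := S.phase_mul_conj hjN
  rw [map_div₀, Complex.conj_ofReal, mul_comm] at hp
  rw [h, phased, smul_smul, hp, one_smul]

end IsHessenbergRep

/-! ### The canonical basis of the sequence space -/

open Classical in
/-- The canonical basis vectors `e_n` of `Space N`, with `e_n = 0` if `n` is not an index. -/
noncomputable def padBasis (N : ℕ∞) (n : ℕ) : Space N :=
  if h : 1 ≤ n ∧ (n : ℕ∞) ≤ N then basisVec ⟨n, h⟩ else 0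

theorem padBasis_coe (j : Idx N) : padBasis N j.1 = basisVec j := by
  rw [padBasis, dif_pos j.2]

theorem vecEntry_coe (x : Idx N → ℂ) (j : Idx N) : vecEntry x j.1 = x j := by
  rw [vecEntry, dif_pos j.2]

theorem vecEntry_eq_zero (x : Idx N → ℂ) {n : ℕ} (h : ¬(1 ≤ n ∧ (n : ℕ∞) ≤ N)) :
    vecEntry x n = 0 := by
  rw [vecEntry, dif_neg h]

theorem inner_padBasis (n : ℕ) (v : Space N) : ⟪padBasis N n, v⟫_ℂ = vecEntry v n := by
  by_cases h : 1 ≤ n ∧ (n : ℕ∞) ≤ N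
  · rw [padBasis, dif_pos h, basisVec, lp.inner_single_left, vecEntry, dif_pos h]
    simp
  · rw [padBasis, dif_neg h, inner_zero_left, vecEntry_eq_zero _ h]

theorem space_ext {v w : Space N} (h : ∀ n, ⟪padBasis N n, v⟫_ℂ = ⟪padBasis N n, w⟫_ℂ) :
    v = w := by
  ext i
  have := h i.1
  rwa [inner_padBasis, inner_padBasis, vecEntry_coe, vecEntry_coe] at this

theorem padBasis_orthoSeq : OrthoSeq N (padBasis N) := by
  intro i j
  rw [inner_padBasis]
  by_cases hi : 1 ≤ i ∧ (i : ℕ∞) ≤ N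
  swap
  · rw [vecEntry_eq_zero _ hi, if_neg (by tauto)]
  rw [vecEntry, dif_pos hi]
  by_cases hj : 1 ≤ j ∧ (j : ℕ∞) ≤ N
  · rw [padBasis, dif_pos hj, basisVec]
    by_cases hij : i = j
    · subst hij
      rw [lp.single_apply_self, if_pos ⟨rfl, hi⟩]
    · rw [lp.single_apply_ne _ _ _ (by simpa using hij), if_neg (by tauto)]
  · rw [padBasis, dif_neg hj, if_neg (by rintro ⟨rfl, h⟩; exact hj h)]
    rfl

theorem IsMatrixOf.inner_padBasis_apply {T : Space N →L[ℂ] Space N}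
    {M : Matrix (Idx N) (Idx N) ℂ} (hT : IsMatrixOf T M) (i j : ℕ) :
    ⟪padBasis N i, T (padBasis N j)⟫_ℂ = matEntry M i j := by
  rw [inner_padBasis]
  by_cases hi : 1 ≤ i ∧ (i : ℕ∞) ≤ N
  swap
  · rw [vecEntry_eq_zero _ hi, matEntry_eq_zero _ (by tauto)]
  by_cases hj : 1 ≤ j ∧ (j : ℕ∞) ≤ N
  · rw [padBasis, dif_pos hj, vecEntry, dif_pos hi, hT]
    exact (matEntry_coe M ⟨i, hi⟩ ⟨j, hj⟩).symm
  · rw [padBasis, dif_neg hj, map_zero, matEntry_eq_zero _ (by tauto), vecEntry, dif_pos hi]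
    rfl

theorem isHessenbergRep {T : Space N →L[ℂ] Space N} (hT : IsMatrixOf T H)
    (hU : T ∈ unitary (Space N →L[ℂ] Space N)) (hH : IsIrreducibleHessenberg H) :
    IsHessenbergRep H (padBasis N) T where
  orth := padBasis_orthoSeq
  unitary := hU
  map_e j := by
    refine space_ext fun i => ?_
    rw [hT.inner_padBasis_apply, inner_sum]
    simp only [inner_smul_right, padBasis_orthoSeq _ _]
    by_cases hi : 1 ≤ i ∧ (i : ℕ∞) ≤ N
    swap
    · rw [matEntry_eq_zero _ (by tauto), Finset.sum_eq_zero fun k _ => by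
        rw [if_neg (by tauto), mul_zero]]
    by_cases hij : i < j + 2
    · rw [Finset.sum_eq_single_of_mem i (by simpa using hij) fun k _ hk => by
        rw [if_neg (by tauto), mul_zero], if_pos ⟨rfl, hi⟩, mul_one]
    · rw [Finset.sum_eq_zero fun k hk => by
        rw [Finset.mem_range] at hk
        rw [if_neg (by omega), mul_zero]]
      by_cases hj : 1 ≤ j ∧ (j : ℕ∞) ≤ N
      · exact (matEntry_coe H ⟨i, hi⟩ ⟨j, hj⟩).trans (hH.1 _ _ (by simp only; omega))
      · rw [matEntry_eq_zero _ (by tauto)]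
  subdiag_ne n h1 hn := by
    have hn' : (n : ℕ∞) ≤ N := le_trans (by exact_mod_cast n.le_succ) hn
    rw [show matEntry H (n + 1) n = H ⟨n + 1, by omega, hn⟩ ⟨n, h1, hn'⟩ from
      matEntry_coe H ⟨n + 1, by omega, hn⟩ ⟨n, h1, hn'⟩]
    exact hH.2 _ _ rfl

/-! ### The column recursion -/

theorem isParaTridiagonal_fiveDiag (N : ℕ∞) (a : ℕ → ℂ) : IsParaTridiagonal (fiveDiag N a) := by
  refine ⟨fun i j h => ?_, fun i j h1 h2 => ?_, fun i j h1 h2 => ?_⟩ <;>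
  have hi := i.2.1 <;> have hj := j.2.1 <;>
  simp only [fiveDiag, fiveDiagEntry, Nat.odd_iff, Nat.even_iff] at * <;>
  split_ifs <;> first | rfl | omega

theorem ColumnRecursion.unique {C V W : Matrix (Idx N) (Idx N) ℂ} (hV : ColumnRecursion H C V)
    (hW : ColumnRecursion H C W) : W = V := by
  suffices h : ∀ n, ∀ i j : Idx N, j.1 = n → W i j = V i j by
    ext i j; exact h _ i j rfl
  intro n
  induction n using Nat.strong_induction_on with
  | _ n ih =>
  intro i j hj
  have hent : ∀ k l, l < n → matEntry W k l = matEntry V k l := fun k l hl => by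
    by_cases h : (1 ≤ k ∧ (k : ℕ∞) ≤ N) ∧ 1 ≤ l ∧ (l : ℕ∞) ≤ N
    · have := ih l hl ⟨k, h.1⟩ ⟨l, h.2⟩ rfl
      rwa [← matEntry_coe W, ← matEntry_coe V] at this
    · rw [matEntry_eq_zero _ h, matEntry_eq_zero _ h]
  by_cases h2 : j.1 ≤ 2
  · rw [hV.1 i j h2, hW.1 i j h2]
  by_cases hi : i.1 ≤ 2 * j.1 - 2
  · rw [hV.2.1 i j (by omega) hi, hW.2.1 i j (by omega) hi]
    congr 2
    · exact Finset.sum_congr rfl fun k _ => by rw [hent _ _ (by omega)]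
    · refine Finset.sum_congr rfl fun k hk => ?_
      rw [Finset.mem_Icc] at hk
      rw [hent _ _ (by omega)]
  · rw [hV.2.2 i j (by omega) (by omega), hW.2.2 i j (by omega) (by omega)]

/-- The matrix `V` of the coordinates of the vectors `e_j` with respect to the vectors `χ_i`. -/
noncomputable def coordMatrix (H : Matrix (Idx N) (Idx N) ℂ) (e : ℕ → E) (U : E →L[ℂ] E) :
    Matrix (Idx N) (Idx N) ℂ :=
  fun i j => ⟪laurent H e U i.1, e j.1⟫_ℂ

namespace IsHessenbergRep

variable (S : IsHessenbergRep H e U)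
include S

theorem matEntry_coordMatrix (hN : 1 ≤ N) (i j : ℕ) :
    matEntry (coordMatrix H e U) i j = ⟪laurent H e U i, e j⟫_ℂ := by
  by_cases hi : 1 ≤ i ∧ (i : ℕ∞) ≤ N
  swap
  · rw [matEntry_eq_zero _ (by tauto), S.laurent_eq_zero hN hi, inner_zero_left]
  by_cases hj : 1 ≤ j ∧ (j : ℕ∞) ≤ N
  swap
  · rw [matEntry_eq_zero _ (by tauto), S.orth.eq_zero hj, inner_zero_right]
  exact matEntry_coe _ ⟨i, hi⟩ ⟨j, hj⟩

theorem inner_laurent_eq_zero (hN : 1 ≤ N) {i j : ℕ} (hj : 2 ≤ j) (hij : 2 * j - 1 ≤ i) :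
    ⟪laurent H e U i, e j⟫_ℂ = 0 := by
  obtain ⟨l, rfl⟩ : ∃ l, j = l + 1 := ⟨j - 1, by omega⟩
  exact (S.laurent_orthoSeq hN).inner_eq_zero (by omega) (S.mem_initSpan_laurent hN (by omega))

/-- The recursion compares the two expansions of `⟨χ_i, U e_{j-1}⟩`: along the vectors `χ_k` for
`e_{j-1}`, and along the vectors `e_k` for `U e_{j-1}`. -/
theorem columnRecursion (hN : 1 ≤ N) :
    ColumnRecursion H (fiveDiag N (schurParam H)) (coordMatrix H e U) := by
  refine ⟨fun i j hj => ?_, fun i j hj hi => ?_, fun i j hj hi => ?_⟩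
  · have hj1 := j.2.1
    rw [coordMatrix, S.eq_smul_laurent (by omega) j.2.2, inner_smul_right, S.laurent_orthoSeq hN]
    simp [Subtype.ext_iff, i.2.1, i.2.2]
  · obtain ⟨m, hm⟩ : ∃ m, j.1 = m + 1 + 1 := ⟨j.1 - 2, by omega⟩
    have hexp := (S.laurent_orthoSeq hN).sum_inner (S.mem_initSpan_laurent hN (show 1 ≤ m by omega))
    -- `e_{j-1}` lies in the span of `χ_1, …, χ_{2j-4}`, and row `i` of `C` is five-diagonal
    have h1 : ⟪laurent H e U i.1, U (e (m + 1))⟫_ℂ =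
        ∑ k ∈ Finset.Icc (i.1 - 2) (min (i.1 + 2) (2 * j.1 - 4)),
          matEntry (fiveDiag N (schurParam H)) i.1 k *
            matEntry (coordMatrix H e U) k (m + 1) := by
      conv_lhs => rw [hexp]
      rw [map_sum, inner_sum]
      have hterm : ∀ k, ⟪laurent H e U i.1, U (⟪laurent H e U k, e (m + 1)⟫_ℂ •
          laurent H e U k)⟫_ℂ = matEntry (fiveDiag N (schurParam H)) i.1 k *
            matEntry (coordMatrix H e U) k (m + 1) := fun k => by
        rw [S.matEntry_coordMatrix hN, map_smul, inner_smul_right, mul_comm]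
        by_cases hk : 1 ≤ k ∧ (k : ℕ∞) ≤ N
        · rw [S.inner_map_laurent hN i.2.1 i.2.2 hk.1]
          exact congrArg (· * _) (matEntry_coe (fiveDiag N (schurParam H)) i ⟨k, hk⟩).symm
        · rw [S.laurent_eq_zero hN hk]; simp
      simp only [hterm]
      refine (Finset.sum_subset (fun k hk => ?_) fun k hk hk' => ?_).symm
      · rw [Finset.mem_Icc] at hk; rw [Finset.mem_range]; omega
      · rw [Finset.mem_range] at hk
        rw [Finset.mem_Icc] at hk'
        by_cases h : 1 ≤ k ∧ (k : ℕ∞) ≤ N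
        · rw [show matEntry (fiveDiag N (schurParam H)) i.1 k =
            fiveDiag N (schurParam H) i ⟨k, h⟩ from matEntry_coe _ i ⟨k, h⟩,
            (isParaTridiagonal_fiveDiag N _).1 i ⟨k, h⟩ (by simp only; omega), zero_mul]
        · rw [matEntry_eq_zero _ (by tauto), zero_mul]
    -- the lower limit discards only terms with `v_{i,k} = 0`; the term `k = j` is split off
    have h2 : ⟪laurent H e U i.1, U (e (m + 1))⟫_ℂ =
        (∑ k ∈ Finset.Icc (min i.1 ((i.1 + 3) / 2)) (m + 1),
          matEntry H k (m + 1) * matEntry (coordMatrix H e U) i.1 k) +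
        matEntry H (m + 1 + 1) (m + 1) * matEntry (coordMatrix H e U) i.1 (m + 1 + 1) := by
      rw [S.map_e, inner_sum, Finset.sum_range_succ]
      simp only [inner_smul_right, ← S.matEntry_coordMatrix hN]
      congr 1
      refine (Finset.sum_subset (fun k hk => ?_) fun k hk hk' => ?_).symm
      · rw [Finset.mem_Icc] at hk; rw [Finset.mem_range]; omega
      · rw [Finset.mem_range] at hk
        rw [Finset.mem_Icc] at hk'
        rw [S.matEntry_coordMatrix hN]
        obtain rfl | rfl | h : k = 0 ∨ k = 1 ∨ 2 ≤ k := by omega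
        · rw [S.orth.eq_zero (by simp), inner_zero_right, mul_zero]
        · rw [← laurent_one H e U, (S.laurent_orthoSeq hN).inner_ne (by omega), mul_zero]
        · rw [S.inner_laurent_eq_zero hN h (by omega), mul_zero]
    have hne : matEntry H (m + 1 + 1) (m + 1) ≠ 0 :=
      S.subdiag_ne (m + 1) (by omega) (by rw [← hm]; exact j.2.2)
    have hV : coordMatrix H e U i j = matEntry (coordMatrix H e U) i.1 (m + 1 + 1) := by
      rw [← hm, matEntry_coe]
    have hj1 : j.1 - 1 = m + 1 := by omega
    rw [hj1, ← h1, h2, hm, hV, add_sub_cancel_left, one_div, inv_mul_cancel_left₀ hne]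
  · exact S.inner_laurent_eq_zero hN (by omega) hi

end IsHessenbergRep

/-! ### The unitary equivalence -/

/-- The vectors `χ_i` form a Hilbert basis, and `TV` is its coordinate map. -/
theorem exists_unitary_coords {T : Space N →L[ℂ] Space N} (hN : 1 ≤ N)
    (S : IsHessenbergRep H (padBasis N) T) :
    ∃ TV : Space N →L[ℂ] Space N, TV ∈ unitary (Space N →L[ℂ] Space N) ∧
      ∀ (x : Space N) (i : Idx N), TV x i = ⟪laurent H (padBasis N) T i.1, x⟫_ℂ := by
  have ho : Orthonormal ℂ fun i : Idx N => laurent H (padBasis N) T i.1 := by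
    rw [orthonormal_iff_ite]
    intro i j
    rw [S.laurent_orthoSeq hN]
    simp [Subtype.ext_iff, i.2.1, i.2.2]
  have hbot : (Submodule.span ℂ (Set.range fun i : Idx N => laurent H (padBasis N) T i.1))ᗮ = ⊥ := by
    rw [Submodule.eq_bot_iff]
    intro y hy
    refine space_ext fun n => ?_
    rw [inner_zero_right]
    refine S.inner_eq_zero_of_laurent hN (fun m => ?_) n
    by_cases hm : 1 ≤ m ∧ (m : ℕ∞) ≤ N
    · exact (Submodule.mem_orthogonal _ _).1 hy _ (Submodule.subset_span ⟨⟨m, hm⟩, rfl⟩)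
    · rw [S.laurent_eq_zero hN hm, inner_zero_left]
  let b : HilbertBasis (Idx N) ℂ (Space N) := HilbertBasis.mkOfOrthogonalEqBot ho hbot
  refine ⟨(Unitary.linearIsometryEquiv.symm b.repr : _), Subtype.prop _, fun x i => ?_⟩
  rw [Unitary.coe_symm_linearIsometryEquiv_apply]
  change b.repr x i = _
  rw [b.repr_apply_apply, HilbertBasis.coe_mkOfOrthogonalEqBot]

variable {TH TV : Space N →L[ℂ] Space N}

section Coords

variable (S : IsHessenbergRep H (padBasis N) TH) (hN : 1 ≤ N)
  (hV : ∀ (x : Space N) (i : Idx N), TV x i = ⟪laurent H (padBasis N) TH i.1, x⟫_ℂ)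
include S hN hV

theorem vecEntry_coords (x : Space N) (n : ℕ) :
    vecEntry (TV x) n = ⟪laurent H (padBasis N) TH n, x⟫_ℂ := by
  by_cases hn : 1 ≤ n ∧ (n : ℕ∞) ≤ N
  · rw [vecEntry, dif_pos hn, hV]
  · rw [vecEntry_eq_zero _ hn, S.laurent_eq_zero hN hn, inner_zero_left]

theorem star_coords_padBasis (hTV : TV ∈ unitary (Space N →L[ℂ] Space N)) (j : ℕ) :
    star TV (padBasis N j) = laurent H (padBasis N) TH j := by
  have : TV (laurent H (padBasis N) TH j) = padBasis N j := space_ext fun n => by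
    rw [inner_padBasis, vecEntry_coords S hN hV, S.laurent_orthoSeq hN, padBasis_orthoSeq n j]
  rw [← this, star_apply_apply hTV]

theorem isMatrixOf_fiveDiag (hTV : TV ∈ unitary (Space N →L[ℂ] Space N)) :
    IsMatrixOf (TV * TH * star TV) (fiveDiag N (schurParam H)) := by
  intro i j
  rw [← padBasis_coe, mul_apply_eq_comp, mul_apply_eq_comp,
    star_coords_padBasis S hN hV hTV, hV, S.inner_map_laurent hN i.2.1 i.2.2 j.2.1]
  rfl

end Coords

/-! ### Transport of eigenvectors -/

theorem hasEigenvector_iff {T : Space N →L[ℂ] Space N} {z : ℂ} {x : Space N} :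
    Module.End.HasEigenvector (T : Module.End ℂ (Space N)) z x ↔ T x = z • x ∧ x ≠ 0 := by
  rw [Module.End.hasEigenvector_iff, Module.End.mem_eigenspace_iff]; rfl

theorem hasEigenvector_conj (hTV : TV ∈ unitary (Space N →L[ℂ] Space N)) {z : ℂ} {x : Space N}
    (hx : Module.End.HasEigenvector (TH : Module.End ℂ (Space N)) z x) :
    Module.End.HasEigenvector ((TV * TH * star TV : Space N →L[ℂ] Space N) :
      Module.End ℂ (Space N)) z (TV x) := by
  rw [hasEigenvector_iff] at hx ⊢
  refine ⟨?_, fun h => hx.2 ?_⟩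
  · rw [mul_apply_eq_comp, mul_apply_eq_comp, star_apply_apply hTV, hx.1, map_smul]
  · rw [← star_apply_apply hTV x, h, map_zero]

theorem hasEigenvector_of_conj (hTV : TV ∈ unitary (Space N →L[ℂ] Space N)) {z : ℂ}
    {y : Space N} (hy : Module.End.HasEigenvector
      ((TV * TH * star TV : Space N →L[ℂ] Space N) : Module.End ℂ (Space N)) z y) :
    Module.End.HasEigenvector (TH : Module.End ℂ (Space N)) z (star TV y) := by
  rw [hasEigenvector_iff] at hy ⊢
  refine ⟨?_, fun h => hy.2 ?_⟩
  · rw [← map_smul, ← hy.1, mul_apply_eq_comp, mul_apply_eq_comp, star_apply_apply hTV]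
  · rw [← apply_star_apply hTV y, h, map_zero]

theorem norm_eigenvalue (hU : TH ∈ unitary (Space N →L[ℂ] Space N)) {z : ℂ} {x : Space N}
    (hx : TH x = z • x) (h0 : x ≠ 0) : ‖z‖ = 1 := by
  have h : ‖TH x‖ = ‖x‖ := by
    rw [@norm_eq_sqrt_re_inner ℂ, @norm_eq_sqrt_re_inner ℂ _ _ _ _ x, inner_apply_apply hU]
  rw [hx, norm_smul] at h
  exact mul_right_cancel₀ (norm_ne_zero_iff.2 h0) (h.trans (one_mul _).symm)

theorem IsHessenbergRep.vecEntry_eq (S : IsHessenbergRep H (padBasis N) TH) (x : Space N) (n : ℕ) :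
    vecEntry x n = tau H n / (‖tau H n‖ : ℂ) * ⟪phased H (padBasis N) n, x⟫_ℂ := by
  rw [phased, inner_smul_left, inner_padBasis, ← mul_assoc]
  by_cases hn : 1 ≤ n ∧ (n : ℕ∞) ≤ N
  · rw [S.phase_mul_conj hn.2, one_mul]
  · rw [vecEntry_eq_zero _ hn, mul_zero]

theorem pow_apply_eigen {z : ℂ} {x : Space N} (hx : TH x = z • x) (k : ℕ) :
    (TH ^ k) x = z ^ k • x := by
  induction k with
  | zero => simp
  | succ k ih => rw [pow_succ', mul_apply_eq_comp, ih, map_smul, hx, smul_smul, pow_succ]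

end UnitaryHessenberg

theorem mainTheorem4 (N : ℕ∞) (hN : 1 ≤ N)
    (H : Matrix (Idx N) (Idx N) ℂ) (TH : Space N →L[ℂ] Space N)
    (hTH : IsMatrixOf TH H) (hunitary : TH ∈ unitary (Space N →L[ℂ] Space N))
    (hH : IsIrreducibleHessenberg H) :
    (∀ n : Idx N, tau H n.1 ≠ 0 ∧
      ((n.1 : ℕ∞) < N → ‖schurParam H n.1‖ < 1) ∧
      ((n.1 : ℕ∞) = N → ‖schurParam H n.1‖ = 1)) ∧
    IsParaTridiagonal (fiveDiag N (schurParam H)) ∧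
    ∃ (V : Matrix (Idx N) (Idx N) ℂ) (TC TV : Space N →L[ℂ] Space N),
      ColumnRecursion H (fiveDiag N (schurParam H)) V ∧
      (∀ W : Matrix (Idx N) (Idx N) ℂ,
        ColumnRecursion H (fiveDiag N (schurParam H)) W → W = V) ∧
      IsMatrixOf TC (fiveDiag N (schurParam H)) ∧
      IsMatrixOf TV V ∧
      TV ∈ unitary (Space N →L[ℂ] Space N) ∧
      TH = star TV * TC * TV ∧
      (∀ z : ℂ, Module.End.HasEigenvalue (TH : Module.End ℂ (Space N)) z ↔
        Module.End.HasEigenvalue (TC : Module.End ℂ (Space N)) z) ∧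
      ∀ (z : ℂ) (x y : Space N),
        Module.End.HasEigenvector (TH : Module.End ℂ (Space N)) z x →
        Module.End.HasEigenvector (TC : Module.End ℂ (Space N)) z y →
        vecEntry x 1 ≠ 0 ∧ vecEntry y 1 ≠ 0 ∧
        (vecEntry x 1 = vecEntry y 1 → (vecEntry y 1).im = 0 →
          ∀ k : ℕ, 1 ≤ k →
            vecEntry x (2 * k - 1) =
              tau H (2 * k - 1) / (‖tau H (2 * k - 1)‖ : ℂ) * z ^ (1 - (k : ℤ)) *
                conj (vecEntry y (2 * k - 1)) ∧
            vecEntry x (2 * k) =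
              tau H (2 * k) / (‖tau H (2 * k)‖ : ℂ) * z ^ (1 - (k : ℤ)) *
                vecEntry y (2 * k)) := by
  have S := isHessenbergRep hTH hunitary hH
  obtain ⟨TV, hTV, hV⟩ := exists_unitary_coords hN S
  have hcol := S.columnRecursion hN
  refine ⟨fun n => ⟨S.tau_ne n.2.2, fun h => S.norm_schurParam_lt n.2.1 ?_,
    S.norm_schurParam_last n.2.1⟩, isParaTridiagonal_fiveDiag _ _,
    coordMatrix H (padBasis N) TH, TV * TH * star TV, TV, hcol, fun W hW => hcol.unique hW,
    isMatrixOf_fiveDiag S hN hV hTV, fun i j => ?_, hTV, ?_, fun z => ⟨fun h => ?_, fun h => ?_⟩,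
    fun z x y hx hy => ?_⟩
  · push_cast; exact Order.add_one_le_of_lt h
  · rw [← padBasis_coe, hV]; rfl
  · simp only [mul_assoc, Unitary.star_mul_self_of_mem hTV, mul_one]
    rw [← mul_assoc, Unitary.star_mul_self_of_mem hTV, one_mul]
  · obtain ⟨v, hv⟩ := h.exists_hasEigenvector
    exact Module.End.hasEigenvalue_of_hasEigenvector (hasEigenvector_conj hTV hv)
  · obtain ⟨v, hv⟩ := h.exists_hasEigenvector
    exact Module.End.hasEigenvalue_of_hasEigenvector (hasEigenvector_of_conj hTV hv)
  obtain ⟨hx, hx0⟩ := hasEigenvector_iff.1 hx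
  obtain ⟨hy', hy0'⟩ := hasEigenvector_iff.1 (hasEigenvector_of_conj hTV hy)
  have hz := norm_eigenvalue hunitary hx hx0
  have hz0 : z ≠ 0 := norm_ne_zero_iff.1 (by rw [hz]; exact one_ne_zero)
  have hzz : z * conj z = 1 := by rw [Complex.mul_conj', hz]; simp
  -- eigenvectors are determined by their first coordinate
  have hinj : ∀ v : Space N, TH v = z • v → vecEntry v 1 = 0 → v = 0 := fun v hv h =>
    S.eq_zero_of_eigen hv hz0 (fun w hw => space_ext fun n => by rw [hw, inner_zero_right])
      (by rwa [inner_padBasis])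
  have hy : ∀ n, vecEntry y n = inner ℂ (laurent H (padBasis N) TH n) (star TV y) := fun n => by
    rw [← vecEntry_coords S hN hV, apply_star_apply hTV]
  have hy1 : vecEntry y 1 = vecEntry (star TV y) 1 := by
    rw [hy, laurent_one, inner_padBasis]
  refine ⟨fun h => hx0 (hinj x hx h), fun h => hy0' (hinj _ hy' (hy1 ▸ h)), fun hxy him k hk => ?_⟩
  -- by the normalization, the coordinates of `x` along `χ` are those of `y`
  have hxy' : star TV y = x := by
    rw [← sub_eq_zero]
    refine hinj _ (by rw [map_sub, hy', hx, smul_sub]) ?_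
    rw [← inner_padBasis, inner_sub_right, inner_padBasis, inner_padBasis, ← hy1, hxy, sub_self]
  rw [hxy'] at hy
  have hrel := S.inner_phased_eq hN hx hz (by rw [inner_padBasis, hxy]; exact him)
  obtain ⟨l, rfl⟩ : ∃ l, k = l + 1 := ⟨k - 1, by omega⟩
  have hexp : z ^ (1 - ((l + 1 : ℕ) : ℤ)) = (z ^ l)⁻¹ := by
    rw [← zpow_natCast, ← zpow_neg]; congr 1; push_cast; ring
  have hzl : z ^ l ≠ 0 := pow_ne_zero _ hz0
  rw [hexp, show 2 * (l + 1) - 1 = 2 * l + 1 by omega, show 2 * (l + 1) = 2 * l + 2 by omega,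
    S.vecEntry_eq x (2 * l + 1), S.vecEntry_eq x (2 * l + 2), hy, hy, laurent_odd, laurent_even,
    inner_star_left, inner_star_left, pow_apply_eigen hx, inner_smul_right, inner_smul_right,
    map_mul, ← hrel, map_pow]
  refine ⟨?_, by field_simp⟩
  have hpow : z ^ l * conj z ^ l = 1 := by rw [← mul_pow, hzz, one_pow]
  rw [mul_assoc _ (z ^ l)⁻¹, two_mul, pow_add]
  congr 1
  field_simp
  linear_combination (-inner ℂ (phased H (padBasis N) (l + l + 1)) x) * hpow
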